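/- A directed graph $E=(E^0,E^1,r,s)$ consists of a set $E^0$ of vertices, a set $E^1$ of edges, and range and source maps $r,s:E^1\to E^0$. It has no sinks if every vertex is the source of some edge, and no sources if every vertex is the range of some edge. Give $E^0$ the discrete topology. The graph correspondence $X(E)$ is the $C^*$-correspondence over $A=C_0(E^0)$ of all $\xi:E^1\to\mathbb C$ for which $v\mapsto\sum_{r(e)=v}|\xi(e)|^2$ is in $C_0(E^0)$, with $(a\cdot\xi)(e)=a(s(e))\xi(e)$, $(\xi\cdot b)(e)=\xi(e)b(r(e))$ and $\langle\xi,\eta\rangle(v)=\sum_{r(e)=v}\overline{\xi(e)}\eta(e)$. For a $C^*$-correspondence $X$ over a $C^*$-algebra $A$, let $X^{\otimes n}$ denote the $n$-fold $A$-balanced (completed) tensor product of $X$ with itself, with $X^{\otimes 0}=A$, where $A$ is the identity correspondence over itself: the actions are multiplication and $\langle a,b\rangle=a^*b$. Two $C^*$-correspondences over $A$ are isomorphic if there is a bijection between them that preserves the left action of $A$ and the $A$-valued inner product. We say $X$ is nonperiodic if, for all integers $n\ge 0$, $X^{\otimes n}\cong A$ as $C^*$-correspondences implies $n=0$. A simple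 cycle of length $n\ge 1$ is a graph with $n$ distinct vertices $v_1,\dots,v_n$ and exactly $n$ edges $e_1,\dots,e_n$, where $s(e_i)=v_i$, $r(e_i)=v_{i+1}$ for $i<n$, and $r(e_n)=v_1$. **Proposition.** Let $E$ be a directed graph with finitely many vertices, no sinks and no sources ($E$ may have infinitely many edges). Then the following are equivalent: 1. $X(E)$ is nonperiodic. 2. $E$ is not a disjoint union of simple cycles. (The empty graph counts as an empty disjoint union.) -/

import Mathlib

open scoped ComplexConjugate TensorProduct ZeroAtInfty

universe u

/-- A `C*`-correspondence over a (not necessarily unital) `C*`-algebra `A`: a right Hilbert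
`A`-module, with `A`-valued inner product conjugate-linear in the first variable and complete in the
norm `‖x‖ = ‖⟨x, x⟩‖ ^ (1/2)`, together with a `*`-homomorphism `left` from `A` to the adjointable
operators: the adjoint of `left a` is `left (star a)`. The right action is `x · a = right a x`.
(`CStarModule` in Mathlib is the left-handed notion, with `⟨x, a • y⟩ = a * ⟨x, y⟩`.) -/
structure CStarCorrespondence (A : Type u) [NonUnitalCStarAlgebra A] where
  carrier : Type u
  [normedAddCommGroup : NormedAddCommGroup carrier]
  [normedSpace : NormedSpace ℂ carrier]
  [completeSpace : CompleteSpace carrier]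
  inner : carrier →ₗ⋆[ℂ] carrier →ₗ[ℂ] A
  right : A →ₗ[ℂ] carrier →L[ℂ] carrier
  left : A →ₙₐ[ℂ] carrier →L[ℂ] carrier
  right_mul : ∀ a b x, right (a * b) x = right b (right a x)
  inner_right : ∀ a x y, inner x (right a y) = inner x y * a
  star_inner : ∀ x y, star (inner x y) = inner y x
  inner_self_nonneg : ∀ x, ∃ b, inner x x = star b * b
  norm_sq_eq : ∀ x, ‖x‖ ^ 2 = ‖inner x x‖
  inner_left : ∀ a x y, inner (left a x) y = inner x (left (star a) y)

attribute [instance] CStarCorrespondence.normedAddCommGroup CStarCorrespondence.normedSpace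
  CStarCorrespondence.completeSpace

/-- The data of a `C*`-correspondence, without definiteness and completeness of the norm. -/
structure PreCorrespondence (A : Type u) [NonUnitalCStarAlgebra A] where
  carrier : Type u
  [addCommGroup : AddCommGroup carrier]
  [module : Module ℂ carrier]
  inner : carrier →ₗ⋆[ℂ] carrier →ₗ[ℂ] A
  right : A →ₗ[ℂ] Module.End ℂ carrier
  left : A →ₙₐ[ℂ] Module.End ℂ carrier
  right_mul : ∀ a b x, right (a * b) x = right b (right a x)
  inner_right : ∀ a x y, inner x (right a y) = inner x y * a
  star_inner : ∀ x y, star (inner x y) = inner y x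
  inner_self_nonneg : ∀ x, ∃ b, inner x x = star b * b
  inner_left : ∀ a x y, inner (left a x) y = inner x (left (star a) y)

attribute [instance] PreCorrespondence.addCommGroup PreCorrespondence.module

namespace PreCorrespondence

variable {A : Type u} [NonUnitalCStarAlgebra A] (P : PreCorrespondence A)

theorem inner_right_left (a : A) (x y : P.carrier) :
    P.inner (P.right a x) y = star a * P.inner x y := by
  rw [← P.star_inner, P.inner_right, star_mul, P.star_inner]

theorem norm_inner_sq_le (x y : P.carrier) :
    ‖P.inner x y‖ ^ 2 ≤ ‖P.inner x x‖ * ‖P.inner y y‖ := by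
  let _ : PartialOrder A := CStarAlgebra.spectralOrder A
  have _ : StarOrderedRing A := CStarAlgebra.spectralOrderedRing A
  have key : ∀ K : ℝ, ‖P.inner x x‖ < K → ‖P.inner x y‖ ^ 2 ≤ K * ‖P.inner y y‖ := by
    intro K hK
    have hK0 : 0 < K := lt_of_le_of_lt (norm_nonneg _) hK
    set a := P.inner x y with ha
    have hxx : 0 ≤ P.inner x x :=
      CStarAlgebra.nonneg_iff_eq_star_mul_self.2 (P.inner_self_nonneg x)
    have h0 : 0 ≤ P.inner (P.right a x - (K : ℂ) • y) (P.right a x - (K : ℂ) • y) :=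
      CStarAlgebra.nonneg_iff_eq_star_mul_self.2 (P.inner_self_nonneg _)
    have h1 : P.inner (P.right a x - (K : ℂ) • y) (P.right a x - (K : ℂ) • y)
        = star a * P.inner x x * a - (2 * K) • (star a * a) + (K ^ 2) • P.inner y y := by
      have hyx : P.inner y x = star a := by rw [ha, P.star_inner]
      have hc : ∀ (r : ℝ) (z : A), r • z = (r : ℂ) • z := fun r z => rfl
      simp only [map_sub, LinearMap.sub_apply, LinearMap.map_smulₛₗ, LinearMap.smul_apply,
        P.inner_right, P.inner_right_left, map_smul, hyx, ← ha, Complex.conj_ofReal, hc]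
      push_cast
      module
    have h2 : star a * P.inner x x * a ≤ K • (star a * a) :=
      (CStarAlgebra.star_left_conjugate_le_norm_smul).trans
        (by
          have := star_mul_self_nonneg a
          gcongr)
    have h3 : K • (star a * a) ≤ (K ^ 2) • P.inner y y := by
      have h4 : 0 ≤ K • (star a * a) - (2 * K) • (star a * a) + (K ^ 2) • P.inner y y := by
        rw [h1] at h0
        exact h0.trans (by gcongr)
      have h5 : K • (star a * a) - (2 * K) • (star a * a) + (K ^ 2) • P.inner y y
        = (K ^ 2) • P.inner y y - K • (star a * a) := by module
      rw [h5] at h4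
      exact sub_nonneg.1 h4
    have h6 := CStarAlgebra.norm_le_norm_of_nonneg_of_le
      (smul_nonneg hK0.le (star_mul_self_nonneg a)) h3
    rw [norm_smul, norm_smul, CStarRing.norm_star_mul_self, Real.norm_of_nonneg hK0.le,
      Real.norm_of_nonneg (by positivity)] at h6
    have : K * (‖a‖ ^ 2) ≤ K * (K * ‖P.inner y y‖) := by nlinarith
    exact le_of_mul_le_mul_left this hK0
  have hc : Filter.Tendsto (fun K : ℝ => K * ‖P.inner y y‖)
      (nhdsWithin ‖P.inner x x‖ (Set.Ioi ‖P.inner x x‖)) (nhds (‖P.inner x x‖ * ‖P.inner y y‖)) :=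
    ((continuous_id.mul continuous_const).tendsto _).mono_left nhdsWithin_le_nhds
  exact ge_of_tendsto hc (Filter.eventually_of_mem self_mem_nhdsWithin key)

theorem seminormCore :
    let _ : Norm P.carrier := ⟨fun x => √‖P.inner x x‖⟩
    SeminormedSpace.Core ℂ P.carrier := by
  let _ : Norm P.carrier := ⟨fun x => √‖P.inner x x‖⟩
  have hn : ∀ x : P.carrier, ‖x‖ = √‖P.inner x x‖ := fun _ => rfl
  refine ⟨fun x => Real.sqrt_nonneg _, fun c x => ?_, fun x y => ?_⟩
  · rw [hn, hn]
    simp only [LinearMap.map_smulₛₗ, LinearMap.smul_apply, RingHom.id_apply, norm_smul,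
      RCLike.norm_conj, ← mul_assoc]
    rw [Real.sqrt_mul (by positivity), Real.sqrt_mul_self (norm_nonneg _)]
  · have hxy : ∀ x y : P.carrier, ‖P.inner x y‖ ≤ ‖x‖ * ‖y‖ := fun x y => by
      rw [hn, hn, ← Real.sqrt_mul (norm_nonneg _)]
      exact Real.le_sqrt_of_sq_le (P.norm_inner_sq_le x y)
    rw [hn (x + y)]
    refine Real.sqrt_le_iff.2 ⟨add_nonneg (Real.sqrt_nonneg _) (Real.sqrt_nonneg _), ?_⟩
    have hsq : ∀ x : P.carrier, ‖P.inner x x‖ = ‖x‖ ^ 2 := fun x => by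
      rw [hn, Real.sq_sqrt (norm_nonneg _)]
    calc ‖P.inner (x + y) (x + y)‖
        = ‖P.inner x x + P.inner x y + (P.inner y x + P.inner y y)‖ := by
          simp only [map_add, LinearMap.add_apply]
          congr 1; abel
      _ ≤ ‖P.inner x x‖ + ‖P.inner x y‖ + (‖P.inner y x‖ + ‖P.inner y y‖) :=
          (norm_add_le _ _).trans (add_le_add (norm_add_le _ _) (norm_add_le _ _))
      _ ≤ ‖x‖ ^ 2 + ‖x‖ * ‖y‖ + (‖y‖ * ‖x‖ + ‖y‖ ^ 2) := by
          rw [hsq, hsq]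
          gcongr <;> exact hxy _ _
      _ = (‖x‖ + ‖y‖) ^ 2 := by ring

/-- The seminorm `‖⟨x, x⟩‖ ^ (1/2)`. -/
noncomputable instance : SeminormedAddCommGroup P.carrier :=
  letI : Norm P.carrier := ⟨fun x => √‖P.inner x x‖⟩
  SeminormedAddCommGroup.ofCore P.seminormCore

noncomputable instance : NormedSpace ℂ P.carrier :=
  letI : Norm P.carrier := ⟨fun x => √‖P.inner x x‖⟩
  { norm_smul_le := fun c x => (P.seminormCore.norm_smul c x).le }

theorem norm_def (x : P.carrier) : ‖x‖ = √‖P.inner x x‖ := rfl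

theorem norm_sq (x : P.carrier) : ‖x‖ ^ 2 = ‖P.inner x x‖ := by
  rw [norm_def, Real.sq_sqrt (norm_nonneg _)]

theorem norm_inner_le (x y : P.carrier) : ‖P.inner x y‖ ≤ ‖x‖ * ‖y‖ := by
  rw [norm_def, norm_def, ← Real.sqrt_mul (norm_nonneg _)]
  exact Real.le_sqrt_of_sq_le (P.norm_inner_sq_le x y)

theorem norm_right_le (a : A) (x : P.carrier) : ‖P.right a x‖ ≤ ‖a‖ * ‖x‖ := by
  refine le_of_sq_le_sq ?_ (by positivity)
  rw [norm_sq, P.inner_right, P.inner_right_left, mul_pow, norm_sq]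
  calc ‖star a * P.inner x x * a‖ ≤ ‖star a‖ * ‖P.inner x x‖ * ‖a‖ :=
        (norm_mul_le _ _).trans (by gcongr; exact norm_mul_le _ _)
    _ = ‖a‖ ^ 2 * ‖P.inner x x‖ := by rw [norm_star]; ring

/-- In the unitization, `‖h‖ - h = c* c` for a positive `h`; here `c = l + b`. -/
theorem exists_norm_sub (a : A) : ∃ (l : ℂ) (b : A), conj l * l = (‖star a * a‖ : ℂ) ∧
    conj l • b + l • star b + star b * b = - (star a * a) := by
  have ht : IsSelfAdjoint (star a * a) := IsSelfAdjoint.star_mul_self a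
  generalize star a * a = p at ht
  let _ : PartialOrder (Unitization ℂ A) := CStarAlgebra.spectralOrder _
  have _ : StarOrderedRing (Unitization ℂ A) := CStarAlgebra.spectralOrderedRing _
  have hs : IsSelfAdjoint (p : Unitization ℂ A) := by
    rw [IsSelfAdjoint, ← Unitization.inr_star, ht.star_eq]
  have h1 : 0 ≤ algebraMap ℝ (Unitization ℂ A) ‖(p : Unitization ℂ A)‖ - (p : Unitization ℂ A) :=
    sub_nonneg.2 hs.le_algebraMap_norm_self
  obtain ⟨c, hc⟩ := CStarAlgebra.nonneg_iff_eq_star_mul_self.1 h1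
  have h2 : algebraMap ℝ (Unitization ℂ A) ‖(p : Unitization ℂ A)‖
      = Unitization.inl ((‖p‖ : ℝ) : ℂ) := by
    rw [Unitization.norm_inr]; rfl
  rw [h2, sub_eq_add_neg, ← Unitization.inr_neg] at hc
  refine ⟨c.fst, c.snd, ?_, ?_⟩
  · simpa using (Unitization.ext_iff.1 hc).1.symm
  · simpa using (Unitization.ext_iff.1 hc).2.symm

theorem norm_left_le (a : A) (x : P.carrier) : ‖P.left a x‖ ≤ ‖a‖ * ‖x‖ := by
  let _ : PartialOrder A := CStarAlgebra.spectralOrder A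
  have _ : StarOrderedRing A := CStarAlgebra.spectralOrderedRing A
  obtain ⟨l, b, h1, h2⟩ := exists_norm_sub a
  have h0 : 0 ≤ P.inner (l • x + P.left b x) (l • x + P.left b x) :=
    CStarAlgebra.nonneg_iff_eq_star_mul_self.2 (P.inner_self_nonneg _)
  have h3 : P.inner (l • x + P.left b x) (l • x + P.left b x)
      = (‖star a * a‖ : ℂ) • P.inner x x - P.inner (P.left a x) (P.left a x) := by
    have h4 : P.inner x (P.left (conj l • b + l • star b + star b * b) x)
      = - P.inner (P.left a x) (P.left a x) := by
      rw [h2, P.inner_left, map_neg, map_mul]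
      simp
    rw [← h1, sub_eq_add_neg, ← h4]
    simp only [map_add, LinearMap.add_apply, LinearMap.map_smulₛₗ, LinearMap.smul_apply,
      map_smul, P.inner_left, map_mul, Module.End.mul_apply]
    module
  rw [h3] at h0
  have h5 := CStarAlgebra.norm_le_norm_of_nonneg_of_le
    (CStarAlgebra.nonneg_iff_eq_star_mul_self.2 (P.inner_self_nonneg _)) (sub_nonneg.1 h0)
  refine le_of_sq_le_sq ?_ (by positivity)
  rw [norm_sq, mul_pow, norm_sq]
  rw [norm_smul, CStarRing.norm_star_mul_self] at h5
  simpa [sq] using h5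

open UniformSpace in
/-- The extension of the inner product to the Hausdorff completion. -/
noncomputable def completionInner : Completion P.carrier → Completion P.carrier → A :=
  Function.curry ((Completion.isDenseInducing_coe.prodMap Completion.isDenseInducing_coe).extend
    (Function.uncurry fun x y : P.carrier => P.inner x y))

theorem continuous_inner :
    Continuous (Function.uncurry fun x y : P.carrier => P.inner x y) :=
  let L := LinearMap.mkContinuous₂ P.inner 1 (fun x y => by simpa using P.norm_inner_le x y)
  (L.continuous.comp continuous_fst).clm_apply continuous_snd

open UniformSpace in
@[simp]
theorem completionInner_coe (x y : P.carrier) :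
    P.completionInner (x : Completion P.carrier) (y : Completion P.carrier) = P.inner x y :=
  (Completion.isDenseInducing_coe.prodMap Completion.isDenseInducing_coe).extend_eq
    P.continuous_inner (x, y)

open UniformSpace in
theorem continuous_completionInner : Continuous (Function.uncurry P.completionInner) := by
  let inner' : P.carrier →+ P.carrier →+ A :=
    { toFun := fun x => (P.inner x).toAddMonoidHom
      map_zero' := by ext x; simp
      map_add' := fun x y => by ext z; simp }
  have h : Continuous fun p : P.carrier × P.carrier => inner' p.1 p.2 := P.continuous_inner
  exact (Completion.isDenseInducing_toCompl P.carrier).extend_Z_bilin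
    (Completion.isDenseInducing_toCompl P.carrier) h

theorem continuous_completionInner_comp {α : Type*} [TopologicalSpace α]
    {f g : α → UniformSpace.Completion P.carrier} (hf : Continuous f) (hg : Continuous g) :
    Continuous fun x => P.completionInner (f x) (g x) :=
  P.continuous_completionInner.comp (hf.prodMk hg)

/-- The right action by `a` as a bounded operator. -/
noncomputable def rightCLM (a : A) : P.carrier →L[ℂ] P.carrier :=
  (P.right a).mkContinuous ‖a‖ (P.norm_right_le a)

/-- The left action of `a` as a bounded operator. -/
noncomputable def leftCLM (a : A) : P.carrier →L[ℂ] P.carrier :=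
  (P.left a).mkContinuous ‖a‖ (P.norm_left_le a)

@[simp] theorem rightCLM_apply (a : A) (x : P.carrier) : P.rightCLM a x = P.right a x := rfl

@[simp] theorem leftCLM_apply (a : A) (x : P.carrier) : P.leftCLM a x = P.left a x := rfl

open UniformSpace in
theorem completion_clm_ext {f g : Completion P.carrier →L[ℂ] Completion P.carrier}
    (h : ∀ x : P.carrier, f (x : Completion P.carrier) = g (x : Completion P.carrier)) : f = g :=
  ContinuousLinearMap.coeFn_injective (Completion.ext f.continuous g.continuous h)

open UniformSpace in
theorem completionInner_add_right (x y z : Completion P.carrier) :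
    P.completionInner x (y + z) = P.completionInner x y + P.completionInner x z :=
  Completion.induction_on₃ x y z
    (isClosed_eq (P.continuous_completionInner_comp continuous_fst
        ((continuous_fst.comp continuous_snd).add (continuous_snd.comp continuous_snd)))
      ((P.continuous_completionInner_comp continuous_fst (continuous_fst.comp continuous_snd)).add
        (P.continuous_completionInner_comp continuous_fst (continuous_snd.comp continuous_snd))))
    fun a b c => by
      rw [← Completion.coe_add]
      simp only [completionInner_coe, map_add]

open UniformSpace in
theorem completionInner_smul_right (c : ℂ) (x y : Completion P.carrier) :
    P.completionInner x (c • y) = c • P.completionInner x y :=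
  Completion.induction_on₂ x y
    (isClosed_eq (P.continuous_completionInner_comp continuous_fst (continuous_snd.const_smul c))
      ((P.continuous_completionInner_comp continuous_fst continuous_snd).const_smul c))
    fun a b => by
      rw [← Completion.coe_smul]
      simp only [completionInner_coe, map_smul]

open UniformSpace in
theorem star_completionInner (x y : Completion P.carrier) :
    star (P.completionInner x y) = P.completionInner y x :=
  Completion.induction_on₂ x y
    (isClosed_eq (P.continuous_completionInner_comp continuous_fst continuous_snd).star
      (P.continuous_completionInner_comp continuous_snd continuous_fst))
    fun a b => by simp only [completionInner_coe, P.star_inner]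

open UniformSpace in
/-- The inner product of the completion, as a sesquilinear map. -/
noncomputable def completionInnerₛₗ :
    Completion P.carrier →ₗ⋆[ℂ] Completion P.carrier →ₗ[ℂ] A :=
  LinearMap.mk₂'ₛₗ (starRingEnd ℂ) (RingHom.id ℂ) P.completionInner
    (fun x y z => by
      rw [← star_completionInner, completionInner_add_right, star_add, star_completionInner,
        star_completionInner])
    (fun c x y => by
      rw [← star_completionInner, completionInner_smul_right, star_smul, star_completionInner]
      rfl)
    (fun x y z => P.completionInner_add_right x y z)
    (fun c x y => P.completionInner_smul_right c x y)

open UniformSpace in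
@[simp]
theorem completionInnerₛₗ_coe (x y : P.carrier) :
    P.completionInnerₛₗ (x : Completion P.carrier) (y : Completion P.carrier) = P.inner x y :=
  P.completionInner_coe x y

/-- The right action on the completion. -/
noncomputable def completionRight :
    A →ₗ[ℂ] UniformSpace.Completion P.carrier →L[ℂ] UniformSpace.Completion P.carrier where
  toFun a := (P.rightCLM a).completion
  map_add' a b := P.completion_clm_ext fun x => by simp [← UniformSpace.Completion.coe_add]
  map_smul' c a := P.completion_clm_ext fun x => by simp [← UniformSpace.Completion.coe_smul]

/-- The left action on the completion. -/
noncomputable def completionLeft :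
    A →ₙₐ[ℂ] UniformSpace.Completion P.carrier →L[ℂ] UniformSpace.Completion P.carrier where
  toFun a := (P.leftCLM a).completion
  map_zero' := P.completion_clm_ext fun x => by simp [UniformSpace.Completion.coe_zero]
  map_add' a b := P.completion_clm_ext fun x => by simp [← UniformSpace.Completion.coe_add]
  map_smul' c a := P.completion_clm_ext fun x => by simp [← UniformSpace.Completion.coe_smul]
  map_mul' a b := P.completion_clm_ext fun x => by simp

open UniformSpace in
@[simp]
theorem completionRight_coe (a : A) (x : P.carrier) :
    P.completionRight a (x : Completion P.carrier) = (P.right a x : P.carrier) := by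
  simp [completionRight]

open UniformSpace in
@[simp]
theorem completionLeft_coe (a : A) (x : P.carrier) :
    P.completionLeft a (x : Completion P.carrier) = (P.left a x : P.carrier) := by
  simp [completionLeft]

open UniformSpace in
/-- The `C*`-correspondence obtained by dividing out the vectors of length zero and completing. -/
noncomputable def completion : CStarCorrespondence A where
  carrier := Completion P.carrier
  inner := P.completionInnerₛₗ
  right := P.completionRight
  left := P.completionLeft
  right_mul a b x := by
    refine Completion.induction_on x (isClosed_eq (ContinuousLinearMap.continuous _)
      ((ContinuousLinearMap.continuous _).comp (ContinuousLinearMap.continuous _))) fun x => ?_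
    simp [P.right_mul]
  inner_right a x y := Completion.induction_on₂ x y
      (isClosed_eq (P.continuous_completionInner_comp continuous_fst
          ((ContinuousLinearMap.continuous _).comp continuous_snd))
        ((P.continuous_completionInner_comp continuous_fst continuous_snd).mul_const _))
      fun x y => by simp [P.inner_right]
  star_inner x y := P.star_completionInner x y
  inner_self_nonneg x := by
    let _ : PartialOrder A := CStarAlgebra.spectralOrder A
    have _ : StarOrderedRing A := CStarAlgebra.spectralOrderedRing A
    rw [← CStarAlgebra.nonneg_iff_eq_star_mul_self]
    refine Completion.induction_on x (isClosed_le continuous_const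
      (P.continuous_completionInner_comp continuous_id continuous_id)) fun x => ?_
    simpa using
      CStarAlgebra.nonneg_iff_eq_star_mul_self.2 (P.inner_self_nonneg x)
  norm_sq_eq x := Completion.induction_on x
      (isClosed_eq (continuous_norm.pow 2)
        (P.continuous_completionInner_comp continuous_id continuous_id).norm)
      fun x => by simp [P.norm_sq]
  inner_left a x y := Completion.induction_on₂ x y
      (isClosed_eq (P.continuous_completionInner_comp
          ((ContinuousLinearMap.continuous _).comp continuous_fst) continuous_snd)
        (P.continuous_completionInner_comp continuous_fst
          ((ContinuousLinearMap.continuous _).comp continuous_snd)))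
      fun x y => by simp [P.inner_left]

end PreCorrespondence

namespace CStarCorrespondence

section tensor

variable {A : Type u} [NonUnitalCStarAlgebra A]

theorem inner_right_left (X : CStarCorrespondence A) (a : A) (x y : X.carrier) :
    X.inner (X.right a x) y = star a * X.inner x y := by
  rw [← X.star_inner, X.inner_right, star_mul, X.star_inner]

theorem nonneg_iff_exists {B : Type*} [NonUnitalCStarAlgebra B] [PartialOrder B]
    [StarOrderedRing B] {b : B} : 0 ≤ b ↔ ∃ c, b = star c * c :=
  CStarAlgebra.nonneg_iff_eq_star_mul_self

theorem exists_negPart {B : Type*} [NonUnitalCStarAlgebra B] [PartialOrder B] [StarOrderedRing B]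
    (M : B) (hM : IsSelfAdjoint M) :
    ∃ d : B, 0 ≤ d ∧ star d * (M * d) = -(d * d * d) ∧ (d = 0 → 0 ≤ M) := by
  have hd0 : 0 ≤ M⁻ := CFC.negPart_nonneg M
  refine ⟨M⁻, hd0, ?_, (CFC.negPart_eq_zero_iff M hM).1⟩
  have h1 : M * M⁻ = -(M⁻ * M⁻) := by
    nth_rewrite 1 [← CFC.posPart_sub_negPart M hM]
    rw [sub_mul, CFC.posPart_mul_negPart, zero_sub]
  rw [h1, (IsSelfAdjoint.of_nonneg hd0).star_eq, mul_neg, mul_assoc]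

/-- A Gram matrix in a Hilbert module is positive: it is of the form `Q* Q`. -/
theorem exists_gram_eq (X : CStarCorrespondence A) {n : ℕ} (x : Fin n → X.carrier) :
    ∃ Q : Fin n → Fin n → A, ∀ i j, X.inner (x i) (x j) = ∑ k, star (Q k i) * Q k j := by
  let _ : PartialOrder A := CStarAlgebra.spectralOrder A
  have _ : StarOrderedRing A := CStarAlgebra.spectralOrderedRing A
  let M : CStarMatrix (Fin n) (Fin n) A := CStarMatrix.ofMatrix fun i j => X.inner (x i) (x j)
  have hM : ∀ i j, M i j = X.inner (x i) (x j) := fun _ _ => rfl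
  have hMs : IsSelfAdjoint M := by
    ext i j
    rw [CStarMatrix.star_apply, hM, hM, X.star_inner]
  obtain ⟨d, hd0, hMd, hd⟩ := exists_negPart M hMs
  have hds : star d = d := (IsSelfAdjoint.of_nonneg hd0).star_eq
  have hdiag : ∀ j, 0 ≤ (star d * (M * d)) j j := by
    intro j
    have : (star d * (M * d)) j j
        = X.inner (∑ i, X.right (d i j) (x i)) (∑ i, X.right (d i j) (x i)) := by
      simp only [CStarMatrix.mul_apply, CStarMatrix.star_apply, map_sum, LinearMap.sum_apply,
        inner_right, inner_right_left, hM, Finset.mul_sum, mul_assoc]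
      exact Finset.sum_comm
    rw [this]
    exact nonneg_iff_exists.2 (X.inner_self_nonneg _)
  have hd3 : 0 ≤ d * d * d := by
    have := star_left_conjugate_nonneg hd0 d
    rwa [hds] at this
  obtain ⟨e, he⟩ := nonneg_iff_exists.1 hd3
  have he0 : e = 0 := by
    ext k j
    have h1 : (star e * e) j j = ∑ k, star (e k j) * e k j := by
      simp only [CStarMatrix.mul_apply, CStarMatrix.star_apply]
    have h2 : ∑ k, star (e k j) * e k j = 0 := by
      refine le_antisymm ?_ (Finset.sum_nonneg fun k _ => star_mul_self_nonneg _)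
      have := hdiag j
      rw [hMd, he, CStarMatrix.neg_apply, h1] at this
      exact neg_nonneg.1 this
    have h3 := (Finset.sum_eq_zero_iff_of_nonneg
      (fun k _ => star_mul_self_nonneg (e k j))).1 h2 k (Finset.mem_univ _)
    exact CStarRing.star_mul_self_eq_zero_iff _ |>.1 h3
  have hd30 : d * d * d = 0 := by rw [he, he0, mul_zero]
  have hdd : d * d = 0 := by
    have : star (d * d) * (d * d) = 0 := by
      rw [star_mul, hds, ← mul_assoc, hd30, zero_mul]
    exact CStarRing.star_mul_self_eq_zero_iff _ |>.1 this
  have hd00 : d = 0 := by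
    have : star d * d = 0 := by rw [hds, hdd]
    exact CStarRing.star_mul_self_eq_zero_iff _ |>.1 this
  have hM0 : 0 ≤ M := hd hd00
  obtain ⟨Q, hQ⟩ := nonneg_iff_exists.1 hM0
  refine ⟨fun k i => Q k i, fun i j => ?_⟩
  rw [← hM, hQ, CStarMatrix.mul_apply]
  simp only [CStarMatrix.star_apply]

variable (X Y : CStarCorrespondence A)

/-- The `A`-valued form on the algebraic tensor product with
`⟨x ⊗ y, x' ⊗ y'⟩ = ⟨y, ⟨x, x'⟩ · y'⟩`. -/
noncomputable def tensorInner :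
    X.carrier ⊗[ℂ] Y.carrier →ₗ⋆[ℂ] X.carrier ⊗[ℂ] Y.carrier →ₗ[ℂ] A :=
  TensorProduct.lift <| LinearMap.mk₂'ₛₗ (starRingEnd ℂ) (starRingEnd ℂ)
    (fun x y => TensorProduct.lift <| LinearMap.mk₂ ℂ
      (fun x' y' => Y.inner y (Y.left (X.inner x x') y'))
      (fun x₁ x₂ y' => by simp) (fun c x' y' => by simp)
      (fun x' y₁ y₂ => by simp) (fun c x' y' => by simp))
    (fun x₁ x₂ y => by ext x' y'; simp)
    (fun c x y => by ext x' y'; simp)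
    (fun x y₁ y₂ => by ext x' y'; simp)
    (fun c x y => by ext x' y'; simp)

@[simp]
theorem tensorInner_tmul (x x' : X.carrier) (y y' : Y.carrier) :
    tensorInner X Y (x ⊗ₜ y) (x' ⊗ₜ y') = Y.inner y (Y.left (X.inner x x') y') := rfl

/-- The right action `(x ⊗ y) · a = x ⊗ (y · a)` on the algebraic tensor product. -/
noncomputable def tensorRight : A →ₗ[ℂ] Module.End ℂ (X.carrier ⊗[ℂ] Y.carrier) where
  toFun a := LinearMap.lTensor X.carrier (Y.right a : Y.carrier →ₗ[ℂ] Y.carrier)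
  map_add' a b := by ext x y; simp
  map_smul' c a := by ext x y; simp

/-- The left action `a · (x ⊗ y) = (a · x) ⊗ y` on the algebraic tensor product. -/
noncomputable def tensorLeft : A →ₙₐ[ℂ] Module.End ℂ (X.carrier ⊗[ℂ] Y.carrier) where
  toFun a := LinearMap.rTensor Y.carrier (X.left a : X.carrier →ₗ[ℂ] X.carrier)
  map_zero' := by ext x y; simp
  map_add' a b := by ext x y; simp
  map_smul' c a := by ext x y; simp [TensorProduct.smul_tmul']
  map_mul' a b := by ext x y; simp

@[simp]
theorem tensorRight_tmul (a : A) (x : X.carrier) (y : Y.carrier) :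
    tensorRight X Y a (x ⊗ₜ y) = x ⊗ₜ Y.right a y := rfl

@[simp]
theorem tensorLeft_tmul (a : A) (x : X.carrier) (y : Y.carrier) :
    tensorLeft X Y a (x ⊗ₜ y) = X.left a x ⊗ₜ y := rfl

/-- The algebraic tensor product with its `A`-valued form and actions. The `A`-balancing relations
`x · a ⊗ y = x ⊗ a · y` hold up to vectors of length zero. -/
noncomputable def preTensor : PreCorrespondence A where
  carrier := X.carrier ⊗[ℂ] Y.carrier
  inner := tensorInner X Y
  right := tensorRight X Y
  left := tensorLeft X Y
  right_mul a b z := by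
    induction z with
    | zero => simp
    | tmul x y => simp [Y.right_mul]
    | add z w hz hw => simp only [map_add, hz, hw]
  inner_right a z w := by
    induction z with
    | zero => simp
    | add z z' hz hz' => simp only [map_add, LinearMap.add_apply, hz, hz', add_mul]
    | tmul x y =>
      induction w with
      | zero => simp
      | add w w' hw hw' => simp only [map_add, hw, hw', add_mul]
      | tmul x' y' =>
        rw [tensorRight_tmul, tensorInner_tmul, tensorInner_tmul,
          ← star_star (X.inner x x'), ← Y.inner_left, Y.inner_right, Y.inner_left]
  star_inner z w := by
    induction z with
    | zero => simp
    | add z z' hz hz' => simp only [map_add, LinearMap.add_apply, hz, hz', star_add]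
    | tmul x y =>
      induction w with
      | zero => simp
      | add w w' hw hw' => simp only [map_add, LinearMap.add_apply, hw, hw', star_add]
      | tmul x' y' => simp [Y.star_inner, Y.inner_left, X.star_inner]
  inner_self_nonneg z := by
    let _ : PartialOrder A := CStarAlgebra.spectralOrder A
    have _ : StarOrderedRing A := CStarAlgebra.spectralOrderedRing A
    rw [← nonneg_iff_exists]
    obtain ⟨n, x, y, rfl⟩ := TensorProduct.exists_sum_tmul_eq z
    obtain ⟨Q, hQ⟩ := X.exists_gram_eq x
    have h : tensorInner X Y (∑ i, x i ⊗ₜ y i) (∑ i, x i ⊗ₜ y i)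
        = ∑ k, Y.inner (∑ i, Y.left (Q k i) (y i)) (∑ i, Y.left (Q k i) (y i)) := by
      simp only [map_sum, LinearMap.sum_apply, tensorInner_tmul, hQ, map_mul,
        sum_apply, mul_apply_eq_comp, Y.inner_left]
      exact (Finset.sum_congr rfl fun j _ => Finset.sum_comm).trans Finset.sum_comm
    rw [h]
    exact Finset.sum_nonneg fun k _ =>
      nonneg_iff_exists.2 (Y.inner_self_nonneg _)
  inner_left a z w := by
    induction z with
    | zero => simp
    | add z z' hz hz' => simp only [map_add, LinearMap.add_apply, hz, hz']
    | tmul x y =>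
      induction w with
      | zero => simp
      | add w w' hw hw' => simp only [map_add, hw, hw']
      | tmul x' y' => simp [X.inner_left]

end tensor

end CStarCorrespondence

namespace PreCorrespondence

variable {A : Type u} [NonUnitalCStarAlgebra A]

/-- A definite and complete `PreCorrespondence` is a `C*`-correspondence. -/
noncomputable def toCStarCorrespondence (P : PreCorrespondence A)
    (hdef : ∀ x, P.inner x x = 0 → x = 0) (hcomplete : CompleteSpace P.carrier) :
    CStarCorrespondence A where
  carrier := P.carrier
  normedAddCommGroup := NormedAddCommGroup.ofSeparation fun x hx =>
    hdef x (norm_eq_zero.1 (by rw [← P.norm_sq, hx, sq, mul_zero]))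
  normedSpace := { norm_smul_le := norm_smul_le }
  completeSpace := hcomplete
  inner := P.inner
  right :=
    { toFun := P.rightCLM
      map_add' := fun a b => by ext x; simp
      map_smul' := fun c a => by ext x; simp }
  left :=
    { toFun := P.leftCLM
      map_zero' := by ext x; simp
      map_add' := fun a b => by ext x; simp
      map_smul' := fun c a => by ext x; simp
      map_mul' := fun a b => by ext x; simp }
  right_mul := P.right_mul
  inner_right := P.inner_right
  star_inner := P.star_inner
  inner_self_nonneg := P.inner_self_nonneg
  norm_sq_eq := P.norm_sq
  inner_left := P.inner_left

end PreCorrespondence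

namespace CStarCorrespondence

variable {A : Type u} [NonUnitalCStarAlgebra A]

/-- The (interior, `A`-balanced) tensor product `X ⊗_A Y`: the Hausdorff completion of the algebraic
tensor product for `⟨x ⊗ y, x' ⊗ y'⟩ = ⟨y, ⟨x, x'⟩ · y'⟩`, with `a · (x ⊗ y) = (a · x) ⊗ y` and
`(x ⊗ y) · a = x ⊗ (y · a)`. -/
noncomputable def tensor (X Y : CStarCorrespondence A) : CStarCorrespondence A :=
  (preTensor X Y).completion

/-- The elementary tensor `x ⊗ y` in `X ⊗_A Y`. -/
noncomputable def tmul (X Y : CStarCorrespondence A) (x : X.carrier) (y : Y.carrier) :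
    (X.tensor Y).carrier :=
  UniformSpace.Completion.coe' (α := (preTensor X Y).carrier) (x ⊗ₜ[ℂ] y : X.carrier ⊗[ℂ] Y.carrier)

theorem inner_tmul (X Y : CStarCorrespondence A) (x x' : X.carrier) (y y' : Y.carrier) :
    (X.tensor Y).inner (X.tmul Y x y) (X.tmul Y x' y') = Y.inner y (Y.left (X.inner x x') y') :=
  (preTensor X Y).completionInner_coe _ _

theorem left_tmul (X Y : CStarCorrespondence A) (a : A) (x : X.carrier) (y : Y.carrier) :
    (X.tensor Y).left a (X.tmul Y x y) = X.tmul Y (X.left a x) y :=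
  (preTensor X Y).completionLeft_coe a _

theorem right_tmul (X Y : CStarCorrespondence A) (a : A) (x : X.carrier) (y : Y.carrier) :
    (X.tensor Y).right a (X.tmul Y x y) = X.tmul Y x (Y.right a y) :=
  (preTensor X Y).completionRight_coe a _

variable (A) in
/-- The identity `C*`-correspondence: `A` over itself, with multiplication and
`⟨a, b⟩ = star a * b`. -/
noncomputable def identity : CStarCorrespondence A where
  carrier := A
  inner := LinearMap.mk₂'ₛₗ (starRingEnd ℂ) (RingHom.id ℂ) (fun a b => star a * b)
    (fun a b c => by rw [star_add, add_mul])
    (fun c a b => by rw [star_smul, smul_mul_assoc]; rfl)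
    (fun a b c => mul_add _ _ _)
    (fun c a b => mul_smul_comm _ _ _)
  right := ((ContinuousLinearMap.mul ℂ A).flip : A →ₗ[ℂ] A →L[ℂ] A)
  left := NonUnitalAlgHom.Lmul ℂ A
  right_mul a b x := (mul_assoc x a b).symm
  inner_right a x y := (mul_assoc (star x) y a).symm
  star_inner x y := by simp
  inner_self_nonneg x := ⟨x, rfl⟩
  norm_sq_eq x := by simp [CStarRing.norm_star_mul_self, sq]
  inner_left a x y := by simp [mul_assoc]

/-- Isomorphism of `C*`-correspondences: a bijection preserving the left action and the inner
product; such a map is automatically linear and preserves the right action. -/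
def Isomorphic (X Y : CStarCorrespondence A) : Prop :=
  ∃ Φ : X.carrier → Y.carrier, Function.Bijective Φ ∧
    (∀ a x, Φ (X.left a x) = Y.left a (Φ x)) ∧
    ∀ x x', Y.inner (Φ x) (Φ x') = X.inner x x'

/-- The tensor powers `X^{⊗ n} = X ⊗_A ⋯ ⊗_A X`, with `X^{⊗ 0} = A`. -/
noncomputable def tensorPow (X : CStarCorrespondence A) : ℕ → CStarCorrespondence A
  | 0 => identity A
  | 1 => X
  | n + 2 => X.tensor (X.tensorPow (n + 1))

/-- `X` is nonperiodic if `X^{⊗ n} ≅ A` as `C*`-correspondences only for `n = 0`. -/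
def Nonperiodic (X : CStarCorrespondence A) : Prop :=
  ∀ n : ℕ, Isomorphic (X.tensorPow n) (identity A) → n = 0

end CStarCorrespondence

/-- A directed graph: sets of vertices and edges with source and range maps; loops and multiple
edges are allowed. -/
structure DirectedGraph where
  V : Type u
  E : Type u
  s : E → V
  r : E → V

namespace DirectedGraph

open Filter Topology

/-- No sinks: every vertex emits an edge. -/
def NoSinks (G : DirectedGraph.{u}) : Prop := ∀ v, ∃ e, G.s e = v

/-- No sources: every vertex receives an edge. -/
def NoSources (G : DirectedGraph.{u}) : Prop := ∀ v, ∃ e, G.r e = v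

/-- Isomorphism of directed graphs. -/
def Isomorphic (G H : DirectedGraph.{u}) : Prop :=
  ∃ (φ : G.V ≃ H.V) (ψ : G.E ≃ H.E),
    (∀ e, H.s (ψ e) = φ (G.s e)) ∧ ∀ e, H.r (ψ e) = φ (G.r e)

/-- The graph that is a simple cycle of length `n`: vertices `0, …, n - 1` and edges
`i ⟶ i + 1` modulo `n`. -/
def cycle (n : ℕ) : DirectedGraph.{0} where
  V := Fin n
  E := Fin n
  s := id
  r := finRotate n

/-- The disjoint union of a family of directed graphs. -/
def disjointUnion {ι : Type u} (G : ι → DirectedGraph.{0}) : DirectedGraph.{u} where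
  V := Σ i, (G i).V
  E := Σ i, (G i).E
  s := Sigma.map id fun i => (G i).s
  r := Sigma.map id fun i => (G i).r

/-- `G` is a (possibly empty) disjoint union of simple cycles, of lengths at least one. -/
def IsDisjointUnionOfSimpleCycles (G : DirectedGraph.{u}) : Prop :=
  ∃ (ι : Type u) (n : ι → ℕ), (∀ i, 1 ≤ n i) ∧
    G.Isomorphic (disjointUnion fun i => cycle (n i))

variable (G : DirectedGraph.{u})

/-- The vertex set is given the discrete topology. -/
instance : TopologicalSpace G.V := ⊥

instance : DiscreteTopology G.V := ⟨rfl⟩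

/-- The functions `ξ : E → ℂ` for which `v ↦ ∑_{r e = v} |ξ e| ^ 2` is a convergent sum for every
`v` and lies in `C₀(V)`. -/
def IsVector (ξ : G.E → ℂ) : Prop :=
  (∀ v, Summable fun e : {e // G.r e = v} => ‖ξ e‖ ^ 2) ∧
    Tendsto (fun v => ∑' e : {e // G.r e = v}, ‖ξ e‖ ^ 2) (cocompact G.V) (𝓝 0)

variable {G}

theorem IsVector.memℓp {ξ : G.E → ℂ} (h : G.IsVector ξ) (v : G.V) :
    Memℓp (fun e : {e // G.r e = v} => ξ e) 2 := by
  refine memℓp_gen ?_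
  simpa using h.1 v

/-- The restriction of `ξ` to the edges with range `v`, as an element of `ℓ²`. -/
def IsVector.slice {ξ : G.E → ℂ} (h : G.IsVector ξ) (v : G.V) :
    lp (fun _ : {e // G.r e = v} => ℂ) 2 :=
  ⟨fun e => ξ e, h.memℓp v⟩

theorem IsVector.norm_slice_sq {ξ : G.E → ℂ} (h : G.IsVector ξ) (v : G.V) :
    ‖h.slice v‖ ^ 2 = ∑' e : {e // G.r e = v}, ‖ξ e‖ ^ 2 := by
  have := lp.norm_rpow_eq_tsum (p := 2) (by simp) (h.slice v)
  have h2 : ‖h.slice v‖ ^ 2 = ∑' e, ‖h.slice v e‖ ^ 2 := by simpa using this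
  exact h2

theorem IsVector.tendsto_slice {ξ : G.E → ℂ} (h : G.IsVector ξ) :
    Tendsto (fun v => ‖h.slice v‖) (cocompact G.V) (𝓝 0) := by
  have h1 := h.2.sqrt
  simp only [← h.norm_slice_sq, Real.sqrt_sq (norm_nonneg _), Real.sqrt_zero] at h1
  exact h1

theorem isVector_of_slice {ξ : G.E → ℂ} (x : ∀ v : G.V, lp (fun _ : {e // G.r e = v} => ℂ) 2)
    (hx : ∀ (v : G.V) (e : {e // G.r e = v}), x v e = ξ e)
    (hlim : Tendsto (fun v => ‖x v‖) (cocompact G.V) (𝓝 0)) : G.IsVector ξ := by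
  have h1 : ∀ v, HasSum (fun e : {e // G.r e = v} => ‖ξ e‖ ^ 2) (‖x v‖ ^ 2) := fun v => by
    have := lp.hasSum_norm (p := 2) (by simp) (x v)
    simpa [hx] using this
  refine ⟨fun v => (h1 v).summable, ?_⟩
  have h2 : (fun v => ∑' e : {e // G.r e = v}, ‖ξ e‖ ^ 2) = fun v => ‖x v‖ ^ 2 :=
    funext fun v => (h1 v).tsum_eq
  rw [h2]
  simpa using hlim.pow 2

theorem IsVector.of_norm_le {ξ η : G.E → ℂ} (h : G.IsVector ξ) (c : ℝ)
    (hη : ∀ e, ‖η e‖ ≤ c * ‖ξ e‖) : G.IsVector η := by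
  have h1 : ∀ e, ‖η e‖ ^ 2 ≤ c ^ 2 * ‖ξ e‖ ^ 2 := fun e => by
    rw [← mul_pow]; exact pow_le_pow_left₀ (norm_nonneg _) (hη e) 2
  have h2 : ∀ v, Summable fun e : {e // G.r e = v} => ‖η e‖ ^ 2 := fun v =>
    Summable.of_nonneg_of_le (fun e => by positivity) (fun e => h1 e) ((h.1 v).mul_left _)
  refine ⟨h2, squeeze_zero (fun v => tsum_nonneg fun e => by positivity) (fun v => ?_)
    (by simpa using h.2.const_mul (c ^ 2))⟩
  rw [← tsum_mul_left]
  exact (h2 v).tsum_le_tsum (fun e => h1 e) ((h.1 v).mul_left _)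

theorem IsVector.add {ξ η : G.E → ℂ} (hξ : G.IsVector ξ) (hη : G.IsVector η) :
    G.IsVector (ξ + η) :=
  isVector_of_slice (fun v => hξ.slice v + hη.slice v) (fun _ _ => rfl)
    (squeeze_zero (fun _ => norm_nonneg _) (fun _ => norm_add_le _ _)
      (by simpa using hξ.tendsto_slice.add hη.tendsto_slice))

variable (G)

/-- The vector space underlying the graph correspondence. -/
def vectors : Submodule ℂ (G.E → ℂ) where
  carrier := {ξ | G.IsVector ξ}
  zero_mem' := ⟨fun v => by simp [summable_zero], by simpa using tendsto_const_nhds⟩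
  add_mem' := IsVector.add
  smul_mem' c ξ h := IsVector.of_norm_le h ‖c‖ fun e => by simp

variable {G}

theorem isVector (ξ : G.vectors) : G.IsVector (ξ : G.E → ℂ) := ξ.2

/-- A function satisfying `IsVector`, as an element of `G.vectors`. -/
def mkVector (ξ : G.E → ℂ) (h : G.IsVector ξ) : G.vectors := ⟨ξ, h⟩

/-- The restriction of a vector to the edges with range `v`. -/
def slice (ξ : G.vectors) (v : G.V) : lp (fun _ : {e // G.r e = v} => ℂ) 2 :=
  (isVector ξ).slice v

theorem slice_ext {ξ η : G.vectors} (h : ∀ v, slice ξ v = slice η v) : ξ = η := by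
  ext e
  exact congrArg (fun x : lp (fun _ : {e' // G.r e' = G.r e} => ℂ) 2 => x ⟨e, rfl⟩) (h (G.r e))

theorem slice_zero (v : G.V) : slice (0 : G.vectors) v = 0 := rfl

theorem slice_add (ξ η : G.vectors) (v : G.V) : slice (ξ + η) v = slice ξ v + slice η v := rfl

theorem slice_sub (ξ η : G.vectors) (v : G.V) : slice (ξ - η) v = slice ξ v - slice η v := rfl

theorem slice_smul (c : ℂ) (ξ : G.vectors) (v : G.V) : slice (c • ξ) v = c • slice ξ v := rfl

theorem tendsto_slice (ξ : G.vectors) :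
    Tendsto (fun v => ‖slice ξ v‖) (cocompact G.V) (𝓝 0) :=
  (isVector ξ).tendsto_slice

theorem inner_slice (ξ η : G.vectors) (v : G.V) : inner ℂ (slice ξ v) (slice η v)
    = ∑' e : {e // G.r e = v}, conj (ξ.1 e) * η.1 e := by
  rw [lp.inner_eq_tsum]
  refine tsum_congr fun e => ?_
  rw [RCLike.inner_apply, mul_comm]
  rfl

/-- The inner product `⟨ξ, η⟩(v) = ∑_{r e = v} conj (ξ e) * η e`. -/
noncomputable def innerFun (ξ η : G.vectors) : C₀(G.V, ℂ) where
  toFun v := ∑' e : {e // G.r e = v}, conj (ξ.1 e) * η.1 e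
  continuous_toFun := continuous_of_discreteTopology
  zero_at_infty' := by
    refine squeeze_zero_norm (a := fun v => ‖slice ξ v‖ * ‖slice η v‖) (fun v => ?_) ?_
    · rw [← inner_slice]
      exact norm_inner_le_norm _ _
    · simpa using (tendsto_slice ξ).mul (tendsto_slice η)

theorem innerFun_apply (ξ η : G.vectors) (v : G.V) :
    innerFun ξ η v = ∑' e : {e // G.r e = v}, conj (ξ.1 e) * η.1 e := rfl

theorem innerFun_eq (ξ η : G.vectors) (v : G.V) :
    innerFun ξ η v = inner ℂ (slice ξ v) (slice η v) := (inner_slice ξ η v).symm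

variable (G) in
/-- The inner product as a sesquilinear map. -/
noncomputable def innerₛₗ : G.vectors →ₗ⋆[ℂ] G.vectors →ₗ[ℂ] C₀(G.V, ℂ) :=
  LinearMap.mk₂'ₛₗ (starRingEnd ℂ) (RingHom.id ℂ) innerFun
    (fun ξ η ζ => by
      ext v
      rw [ZeroAtInftyContinuousMap.add_apply]
      simp only [innerFun_eq, slice_add, inner_add_left])
    (fun c ξ η => by
      ext v
      rw [ZeroAtInftyContinuousMap.smul_apply]
      simp only [innerFun_eq, slice_smul, inner_smul_left, smul_eq_mul])
    (fun ξ η ζ => by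
      ext v
      rw [ZeroAtInftyContinuousMap.add_apply]
      simp only [innerFun_eq, slice_add, inner_add_right])
    (fun c ξ η => by
      ext v
      rw [ZeroAtInftyContinuousMap.smul_apply]
      simp only [innerFun_eq, slice_smul, inner_smul_right, smul_eq_mul, RingHom.id_apply])

/-- Pointwise multiplication by a bounded function on the edges. -/
def mulOp (g : G.E → ℂ) (c : ℝ) (hg : ∀ e, ‖g e‖ ≤ c) : Module.End ℂ G.vectors where
  toFun ξ := mkVector (fun e => g e * ξ.1 e) <| (isVector ξ).of_norm_le c fun e => by
    rw [norm_mul]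
    exact mul_le_mul_of_nonneg_right (hg e) (norm_nonneg _)
  map_add' ξ η := by
    ext e
    change g e * (ξ.1 e + η.1 e) = g e * ξ.1 e + g e * η.1 e
    ring
  map_smul' z ξ := by
    ext e
    change g e * (z * ξ.1 e) = z * (g e * ξ.1 e)
    ring

theorem norm_apply_le (a : C₀(G.V, ℂ)) (v : G.V) : ‖a v‖ ≤ ‖a‖ := a.toBCF.norm_coe_le_norm v

variable (G) in
/-- The right action `(ξ · a)(e) = ξ e * a (r e)`. -/
noncomputable def rightAction : C₀(G.V, ℂ) →ₗ[ℂ] Module.End ℂ G.vectors where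
  toFun a := mulOp (fun e => a (G.r e)) ‖a‖ fun _ => norm_apply_le a _
  map_add' a b := LinearMap.ext fun ξ => Subtype.ext (funext fun e =>
    add_mul (a (G.r e)) (b (G.r e)) (ξ.1 e))
  map_smul' c a := LinearMap.ext fun ξ => Subtype.ext (funext fun e =>
    mul_assoc c (a (G.r e)) (ξ.1 e))

variable (G) in
/-- The left action `(a · ξ)(e) = a (s e) * ξ e`. -/
noncomputable def leftAction : C₀(G.V, ℂ) →ₙₐ[ℂ] Module.End ℂ G.vectors where
  toFun a := mulOp (fun e => a (G.s e)) ‖a‖ fun _ => norm_apply_le a _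
  map_zero' := LinearMap.ext fun ξ => Subtype.ext (funext fun e => zero_mul (ξ.1 e))
  map_add' a b := LinearMap.ext fun ξ => Subtype.ext (funext fun e =>
    add_mul (a (G.s e)) (b (G.s e)) (ξ.1 e))
  map_smul' c a := LinearMap.ext fun ξ => Subtype.ext (funext fun e =>
    mul_assoc c (a (G.s e)) (ξ.1 e))
  map_mul' a b := LinearMap.ext fun ξ => Subtype.ext (funext fun e =>
    mul_assoc (a (G.s e)) (b (G.s e)) (ξ.1 e))

theorem rightAction_apply (a : C₀(G.V, ℂ)) (ξ : G.vectors) (e : G.E) :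
    (G.rightAction a ξ).1 e = ξ.1 e * a (G.r e) := mul_comm _ _

theorem leftAction_apply (a : C₀(G.V, ℂ)) (ξ : G.vectors) (e : G.E) :
    (G.leftAction a ξ).1 e = a (G.s e) * ξ.1 e := rfl

theorem inner_rightAction (a : C₀(G.V, ℂ)) (ξ η : G.vectors) :
    innerFun ξ (G.rightAction a η) = innerFun ξ η * a := by
  ext v
  rw [ZeroAtInftyContinuousMap.mul_apply, innerFun_apply, innerFun_apply, ← tsum_mul_right]
  refine tsum_congr fun e => ?_
  rw [rightAction_apply, e.2, mul_assoc]

theorem inner_leftAction (a : C₀(G.V, ℂ)) (ξ η : G.vectors) :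
    innerFun (G.leftAction a ξ) η = innerFun ξ (G.leftAction (star a) η) := by
  ext v
  rw [innerFun_apply, innerFun_apply]
  refine tsum_congr fun e => ?_
  rw [leftAction_apply, leftAction_apply, map_mul, ZeroAtInftyContinuousMap.star_apply]
  change conj (a _) * _ * _ = _ * (conj (a _) * _)
  ring

theorem star_innerFun (ξ η : G.vectors) : star (innerFun ξ η) = innerFun η ξ := by
  ext v
  rw [ZeroAtInftyContinuousMap.star_apply, innerFun_eq, innerFun_eq]
  exact inner_conj_symm _ _

theorem innerFun_self_nonneg (ξ : G.vectors) : ∃ b, innerFun ξ ξ = star b * b := by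
  refine ⟨⟨⟨fun v => (‖slice ξ v‖ : ℂ), continuous_of_discreteTopology⟩, ?_⟩, ?_⟩
  · exact (Complex.continuous_ofReal.tendsto 0).comp (tendsto_slice ξ)
  · ext v
    change innerFun ξ ξ v = conj (‖slice ξ v‖ : ℂ) * (‖slice ξ v‖ : ℂ)
    rw [innerFun_eq, inner_self_eq_norm_sq_to_K, Complex.conj_ofReal]
    exact sq _

variable (G) in
/-- `G.vectors` with its inner product and actions. -/
noncomputable def preCorrespondence : PreCorrespondence C₀(G.V, ℂ) where
  carrier := G.vectors
  inner := G.innerₛₗ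
  right := G.rightAction
  left := G.leftAction
  right_mul a b ξ := Subtype.ext (funext fun e => by
    simp only [rightAction_apply, ZeroAtInftyContinuousMap.mul_apply, mul_assoc])
  inner_right := inner_rightAction
  star_inner := star_innerFun
  inner_self_nonneg := innerFun_self_nonneg
  inner_left := inner_leftAction

theorem innerFun_definite (ξ : G.vectors) (h : innerFun ξ ξ = 0) : ξ = 0 := by
  refine slice_ext fun v => ?_
  have h1 : innerFun ξ ξ v = 0 := by rw [h]; rfl
  rw [innerFun_eq, inner_self_eq_zero] at h1
  rw [h1, slice_zero]

theorem norm_inner_self (ξ : G.vectors) (v : G.V) :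
    ‖inner ℂ (slice ξ v) (slice ξ v)‖ = ‖slice ξ v‖ ^ 2 := by
  rw [inner_self_eq_norm_sq_to_K, norm_pow, RCLike.norm_ofReal, abs_of_nonneg (norm_nonneg _)]

theorem norm_slice_le (ξ : G.vectors) (v : G.V) : ‖slice ξ v‖ ≤ √‖innerFun ξ ξ‖ := by
  refine Real.le_sqrt_of_sq_le ?_
  have h1 := norm_apply_le (innerFun ξ ξ) v
  rwa [innerFun_eq, norm_inner_self] at h1

theorem norm_le_of_slice {ξ : G.vectors} {C : ℝ} (hC : 0 ≤ C) (h : ∀ v, ‖slice ξ v‖ ≤ C) :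
    √‖innerFun ξ ξ‖ ≤ C := by
  refine Real.sqrt_le_iff.2 ⟨hC, ((innerFun ξ ξ).toBCF.norm_le (by positivity)).2 fun v => ?_⟩
  change ‖innerFun ξ ξ v‖ ≤ C ^ 2
  rw [innerFun_eq, norm_inner_self]
  exact pow_le_pow_left₀ (norm_nonneg _) (h v) 2

theorem vectors_complete (u : ℕ → G.vectors)
    (hu : ∀ ε > 0, ∃ N, ∀ m ≥ N, ∀ n ≥ N, √‖innerFun (u m - u n) (u m - u n)‖ < ε) :
    ∃ ζ : G.vectors, ∀ ε > 0, ∃ N, ∀ n ≥ N, √‖innerFun (u n - ζ) (u n - ζ)‖ < ε := by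
  have hv : ∀ v, CauchySeq fun n => slice (u n) v := fun v => by
    refine Metric.cauchySeq_iff.2 fun ε hε => ?_
    obtain ⟨N, hN⟩ := hu ε hε
    refine ⟨N, fun m hm n hn => ?_⟩
    rw [dist_eq_norm, ← slice_sub]
    exact (norm_slice_le _ v).trans_lt (hN m hm n hn)
  choose x hx using fun v => cauchySeq_tendsto_of_complete (hv v)
  have hunif : ∀ ε > 0, ∃ N, ∀ n ≥ N, ∀ v, ‖slice (u n) v - x v‖ ≤ ε := fun ε hε => by
    obtain ⟨N, hN⟩ := hu ε hε
    refine ⟨N, fun n hn v => ?_⟩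
    refine le_of_tendsto ((tendsto_const_nhds.sub (hx v)).norm)
      (eventually_atTop.2 ⟨N, fun m hm => ?_⟩)
    rw [← slice_sub]
    exact (norm_slice_le _ v).trans (hN n hn m hm).le
  have hlim : Tendsto (fun v => ‖x v‖) (cocompact G.V) (𝓝 0) := by
    refine Metric.tendsto_nhds.2 fun ε hε => ?_
    obtain ⟨N, hN⟩ := hunif (ε / 2) (half_pos hε)
    filter_upwards [Metric.tendsto_nhds.1 (tendsto_slice (u N)) (ε / 2) (half_pos hε)] with v hv'
    rw [Real.dist_eq, sub_zero, abs_of_nonneg (norm_nonneg _)] at hv' ⊢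
    have := norm_sub_norm_le (x v) (slice (u N) v)
    rw [norm_sub_rev] at this
    linarith [hN N le_rfl v]
  have hvec : G.IsVector fun e => x (G.r e) ⟨e, rfl⟩ :=
    isVector_of_slice x (by rintro v ⟨e, rfl⟩; rfl) hlim
  have hζ : ∀ v, slice (mkVector _ hvec) v = x v := fun v => by
    ext ⟨e, rfl⟩
    rfl
  refine ⟨mkVector _ hvec, fun ε hε => ?_⟩
  obtain ⟨N, hN⟩ := hunif (ε / 2) (half_pos hε)
  refine ⟨N, fun n hn => (norm_le_of_slice (half_pos hε).le fun v => ?_).trans_lt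
    (half_lt_self hε)⟩
  rw [slice_sub, hζ]
  exact hN n hn v

theorem preCorrespondence_complete : CompleteSpace G.preCorrespondence.carrier := by
  refine Metric.complete_of_cauchySeq_tendsto fun u hu => ?_
  rw [Metric.cauchySeq_iff] at hu
  simp only [dist_eq_norm] at hu
  obtain ⟨ζ, hζ⟩ := vectors_complete u hu
  let ζ' : G.preCorrespondence.carrier := ζ
  refine ⟨ζ', Metric.tendsto_atTop.2 fun ε hε => ?_⟩
  obtain ⟨N, hN⟩ := hζ ε hε
  refine ⟨N, fun n hn => ?_⟩
  rw [dist_eq_norm]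
  exact hN n hn

variable (G) in
/-- The graph correspondence `X(G)` over `C₀(V)`. -/
noncomputable def correspondence : CStarCorrespondence C₀(G.V, ℂ) :=
  G.preCorrespondence.toCStarCorrespondence innerFun_definite preCorrespondence_complete

end DirectedGraph

/-!
Suppose `X(E)^{⊗ (n + 1)} ≅ A`. The left action of `A` on itself is faithful, hence so is the one on
`X(E)`, which means that `E` has no sinks. So every edge `e` can be followed by an edge `g e`, and
the path `e, g e, …, gⁿ e` gives a vector `x e = e ⊗ g e ⊗ ⋯ ⊗ gⁿ e` in the tensor power. As `A`
is commutative, its left and right actions on itself agree, which forces every such path to end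
where it starts, and `⟨x, x⟩ ⟨y, y⟩ = ⟨y, x⟩ ⟨x, y⟩`, which forces the paths of distinct edges to
start at distinct vertices. Thus `s` is bijective and `g` is a permutation of the edges with
`gⁿ⁺¹ = 1`, whose cycles are the components of `E`.

Conversely, if `r` and `s` are bijective and there are finitely many vertices, then `X(E)` is `A`
with its left action twisted by the permutation `s ∘ r⁻¹` of the vertices. The tensor power of order
`n` is twisted by the `n`-th power of this permutation, which is trivial for some `n ≥ 1`.
-/

namespace CStarCorrespondence

variable {A : Type u} [NonUnitalCStarAlgebra A]

section norm

/-- The underlying `PreCorrespondence` of a `C*`-correspondence; it has the same norm, so it carries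
over the Cauchy–Schwarz inequality and the bound on the right action. -/
noncomputable def toPre (X : CStarCorrespondence A) : PreCorrespondence A where
  carrier := X.carrier
  inner := X.inner
  right := ContinuousLinearMap.coeLM ℂ ∘ₗ X.right
  left :=
    { toFun := fun a => X.left a
      map_zero' := by simp
      map_add' := fun a b => by ext x; simp
      map_smul' := fun c a => by ext x; simp
      map_mul' := fun a b => by ext x; simp }
  right_mul := X.right_mul
  inner_right := X.inner_right
  star_inner := X.star_inner
  inner_self_nonneg := X.inner_self_nonneg
  inner_left := X.inner_left

variable (X : CStarCorrespondence A)

theorem norm_toPre (x : X.toPre.carrier) : ‖x‖ = @norm X.carrier _ x := by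
  rw [PreCorrespondence.norm_def]
  exact (congrArg Real.sqrt (X.norm_sq_eq x).symm).trans (Real.sqrt_sq (norm_nonneg _))

theorem norm_inner_le (x y : X.carrier) : ‖X.inner x y‖ ≤ ‖x‖ * ‖y‖ :=
  (X.toPre.norm_inner_le x y).trans_eq (congrArg₂ (· * ·) (X.norm_toPre x) (X.norm_toPre y))

theorem norm_right_le (a : A) (x : X.carrier) : ‖X.right a x‖ ≤ ‖a‖ * ‖x‖ := calc
  ‖X.right a x‖ = @norm X.toPre.carrier _ (X.right a x) := (X.norm_toPre _).symm
  _ ≤ ‖a‖ * @norm X.toPre.carrier _ x := X.toPre.norm_right_le a x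
  _ = ‖a‖ * ‖x‖ := congrArg (‖a‖ * ·) (X.norm_toPre x)

theorem inner_self_eq_zero {x : X.carrier} : X.inner x x = 0 ↔ x = 0 := by
  rw [← norm_eq_zero, ← X.norm_sq_eq, sq_eq_zero_iff, norm_eq_zero]

/-- The operator `z ↦ x · ⟨y, z⟩`, usually denoted `θ_{x,y}`. -/
noncomputable def rankOne (x y : X.carrier) : X.carrier →L[ℂ] X.carrier :=
  LinearMap.mkContinuous ((ContinuousLinearMap.coeLM ℂ ∘ₗ X.right).flip x ∘ₗ X.inner y)
    (‖x‖ * ‖y‖) fun z => calc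
      ‖X.right (X.inner y z) x‖ ≤ ‖X.inner y z‖ * ‖x‖ := X.norm_right_le _ _
      _ ≤ ‖y‖ * ‖z‖ * ‖x‖ := by gcongr; exact X.norm_inner_le y z
      _ = ‖x‖ * ‖y‖ * ‖z‖ := by ring

@[simp]
theorem rankOne_apply (x y z : X.carrier) : X.rankOne x y z = X.right (X.inner y z) x := rfl

end norm

section tensor

theorem tmul_right (X Y : CStarCorrespondence A) (a : A) (x : X.carrier) (y : Y.carrier) :
    X.tmul Y (X.right a x) y = X.tmul Y x (Y.left a y) := by
  rw [← sub_eq_zero, ← inner_self_eq_zero]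
  simp only [map_sub, LinearMap.sub_apply, inner_tmul, X.inner_right, X.inner_right_left, map_mul,
    Y.inner_left, mul_apply_eq_comp]
  abel

theorem zero_tmul (X Y : CStarCorrespondence A) (y : Y.carrier) : X.tmul Y 0 y = 0 := by
  simp [← inner_self_eq_zero, inner_tmul]

theorem tensor_clm_ext {X Y : CStarCorrespondence A} {F : Type*} [AddCommGroup F] [Module ℂ F]
    [TopologicalSpace F] [T2Space F] {f g : (X.tensor Y).carrier →L[ℂ] F}
    (h : ∀ x y, f (X.tmul Y x y) = g (X.tmul Y x y)) : f = g := by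
  let ι : (preTensor X Y).carrier →ₗ[ℂ] (X.tensor Y).carrier :=
    (UniformSpace.Completion.toComplL (𝕜 := ℂ) (E := (preTensor X Y).carrier)).toLinearMap
  have heq : f.toLinearMap ∘ₗ ι = g.toLinearMap ∘ₗ ι := TensorProduct.ext' h
  exact ContinuousLinearMap.coeFn_injective <|
    UniformSpace.Completion.ext f.continuous g.continuous (LinearMap.congr_fun heq)

theorem left_tensor_eq_zero {X : CStarCorrespondence A} {a : A} (h : X.left a = 0)
    (Y : CStarCorrespondence A) : (X.tensor Y).left a = 0 :=
  tensor_clm_ext fun x y => by simp [left_tmul, h, zero_tmul]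

theorem left_tensorPow_eq_zero {X : CStarCorrespondence A} {a : A} (h : X.left a = 0) :
    ∀ n, (X.tensorPow (n + 1)).left a = 0
  | 0 => h
  | _ + 1 => left_tensor_eq_zero h _

end tensor

section identity

theorem Isomorphic.eq_zero_of_left_eq_zero {X : CStarCorrespondence A}
    (hX : X.Isomorphic (identity A)) {a : A} (h : X.left a = 0) : a = 0 := by
  obtain ⟨Φ, hΦ, hleft, hinner⟩ := hX
  change X.carrier → A at Φ
  obtain ⟨x, hx⟩ := hΦ.2 (star a : A)
  have hΦ0 : Φ 0 = 0 :=
    (identity A).inner_self_eq_zero.1 ((hinner 0 0).trans (map_zero _))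
  have haa : a * star a = 0 := by
    have := hleft a x
    rw [h, hx, zero_apply, hΦ0] at this
    exact this.symm
  exact CStarRing.mul_star_self_eq_zero_iff a |>.1 haa

theorem Isomorphic.inner_left_eq_mul {B : Type u} [NonUnitalCommCStarAlgebra B]
    {X : CStarCorrespondence B} (hX : X.Isomorphic (identity B)) (b : B) (x y : X.carrier) :
    X.inner x (X.left b y) = b * X.inner x y := by
  obtain ⟨Φ, -, hleft, hinner⟩ := hX
  change X.carrier → B at Φ
  rw [← hinner, ← hinner, hleft]
  exact mul_left_comm (star (Φ x)) b (Φ y)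

theorem Isomorphic.inner_self_mul_inner_self {B : Type u} [NonUnitalCommCStarAlgebra B]
    {X : CStarCorrespondence B} (hX : X.Isomorphic (identity B)) (x y : X.carrier) :
    X.inner x x * X.inner y y = X.inner y x * X.inner x y := by
  obtain ⟨Φ, -, -, hinner⟩ := hX
  change X.carrier → B at Φ
  simp only [← hinner]
  change star (Φ x) * Φ x * (star (Φ y) * Φ y) = star (Φ y) * Φ x * (star (Φ x) * Φ y)
  ac_rfl

end identity

section generator

/-- The right module `X` is free on the vector `x`, of square length `u`, and the left action is
multiplication twisted by `α`. It is meant for a unit `u` of `A`; then `X` is the identity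
correspondence with `a` acting from the left as `α a`. -/
structure IsGenerator (X : CStarCorrespondence A) (u : A) (α : A → A) (x : X.carrier) : Prop where
  inner_self : X.inner x x = u
  right_inner : ∀ z, X.right (X.inner x z) x = z
  left_eq : ∀ a, X.left a x = X.right (α a) x

variable {X Y : CStarCorrespondence A} {u : A} {α β : A → A} {x : X.carrier} {y : Y.carrier}

theorem IsGenerator.tmul (hu : ∀ a, u * a = a) (hβ : β u = u) (hx : X.IsGenerator u α x)
    (hy : Y.IsGenerator u β y) : (X.tensor Y).IsGenerator u (β ∘ α) (X.tmul Y x y) where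
  inner_self := by
    rw [inner_tmul, hx.inner_self, hy.left_eq, hβ, Y.inner_right, hy.inner_self, hu]
  left_eq a := by
    rw [left_tmul, hx.left_eq, tmul_right, hy.left_eq, right_tmul, Function.comp_apply]
  right_inner := by
    have hid : (X.tensor Y).rankOne (X.tmul Y x y) (X.tmul Y x y) = .id ℂ _ :=
      tensor_clm_ext fun z w => by
        rw [rankOne_apply, inner_tmul, right_tmul, hy.right_inner, ← tmul_right, hx.right_inner,
          ContinuousLinearMap.id_apply]
    exact DFunLike.congr_fun hid

theorem IsGenerator.tensorPow (hu : ∀ a, u * a = a) (hα : α u = u) (hx : X.IsGenerator u α x) :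
    ∀ n, ∃ y, (X.tensorPow (n + 1)).IsGenerator u α^[n + 1] y
  | 0 => ⟨x, hx⟩
  | n + 1 =>
    have ⟨_, hy⟩ := hx.tensorPow hu hα n
    ⟨_, hx.tmul hu (Function.iterate_fixed hα _) hy⟩

theorem IsGenerator.isomorphic_identity (hu : ∀ a, u * a = a) (hx : X.IsGenerator u id x) :
    X.Isomorphic (identity A) := by
  have inner_right_self (a : A) : X.inner x (X.right a x) = a := by
    rw [X.inner_right, hx.inner_self, hu]
  refine ⟨X.inner x, ⟨fun z w h => ?_, fun a => ⟨X.right a x, inner_right_self a⟩⟩,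
    fun a z => ?_, fun z w => ?_⟩
  · rw [← hx.right_inner z, h, hx.right_inner]
  · calc X.inner x (X.left a z) = X.inner (X.left (star a) x) z := by rw [X.inner_left, star_star]
      _ = a * X.inner x z := by rw [hx.left_eq, X.inner_right_left, id, star_star]
  · calc star (X.inner x z) * X.inner x w = X.inner (X.right (X.inner x z) x) w :=
        (X.inner_right_left _ _ _).symm
      _ = X.inner z w := by rw [hx.right_inner]

end generator

end CStarCorrespondence

theorem exists_sigma_fin_equiv_of_periodic {α : Type u} {f : α → α}
    (hf : ∀ x, x ∈ Function.periodicPts f) :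
    ∃ (ι : Type u) (n : ι → ℕ) (φ : (Σ i, Fin (n i)) ≃ α), (∀ i, 1 ≤ n i) ∧
      ∀ i k, φ ⟨i, finRotate (n i) k⟩ = f (φ ⟨i, k⟩) := by
  let c : Set.range (Function.periodicOrbit f) → α := fun i => i.2.choose
  have hc (i) : Function.periodicOrbit f (c i) = i := i.2.choose_spec
  let n := fun i => Function.minimalPeriod f (c i)
  have hn (i) : 0 < n i := Function.minimalPeriod_pos_of_mem_periodicPts (hf _)
  let φ : (Σ i, Fin (n i)) → α := fun p => f^[p.2] (c p.1)
  have hφ : Function.Bijective φ := by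
    refine ⟨?_, fun x => ?_⟩
    · rintro ⟨i, k⟩ ⟨j, l⟩ (h : f^[k] (c i) = f^[l] (c j))
      obtain rfl : i = j := Subtype.ext <| by
        rw [← hc i, ← hc j, ← Function.periodicOrbit_apply_iterate_eq (hf _) k, h,
          Function.periodicOrbit_apply_iterate_eq (hf _)]
      rw [Function.iterate_eq_iterate_iff_of_lt_minimalPeriod k.2 l.2] at h
      rw [Fin.ext h]
    · let i : Set.range (Function.periodicOrbit f) := ⟨_, x, rfl⟩
      obtain ⟨k, hk⟩ : ∃ k, f^[k] (c i) = x := by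
        rw [← Function.mem_periodicOrbit_iff (hf _), hc]
        exact Function.self_mem_periodicOrbit (hf x)
      exact ⟨⟨i, k % n i, Nat.mod_lt _ (hn i)⟩, Function.iterate_mod_minimalPeriod_eq.trans hk⟩
  refine ⟨_, n, .ofBijective φ hφ, hn, fun i k => ?_⟩
  have := k.neZero
  have hval : (finRotate (n i) k : ℕ) = (k + 1) % n i := by
    rw [finRotate_apply, Fin.val_add, Fin.val_one', Nat.add_mod_mod]
  calc f^[finRotate (n i) k] (c i) = f^[k + 1] (c i) := by
        rw [hval, Function.iterate_mod_minimalPeriod_eq]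
    _ = f (f^[k] (c i)) := Function.iterate_succ_apply' ..

namespace DirectedGraph

open CStarCorrespondence Filter Topology

variable {G : DirectedGraph.{u}}

section cycles

theorem isDisjointUnionOfSimpleCycles_of_periodic (hs : Function.Bijective G.s) {g : G.E → G.E}
    (hg : ∀ e, G.s (g e) = G.r e) (hper : ∀ e, e ∈ Function.periodicPts g) :
    G.IsDisjointUnionOfSimpleCycles := by
  obtain ⟨ι, n, φ, hn, hφ⟩ := exists_sigma_fin_equiv_of_periodic hper
  let S := Equiv.ofBijective _ hs
  have hS (e) : S.symm (G.s e) = e := S.symm_apply_apply e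
  refine ⟨ι, n, hn, S.symm.trans φ.symm, φ.symm, fun e => ?_, fun e => ?_⟩
  · exact congrArg φ.symm (hS e).symm
  · calc (⟨_, finRotate _ (φ.symm e).2⟩ : Σ i, Fin (n i)) = φ.symm (g e) := by
          rw [Equiv.eq_symm_apply, hφ, Sigma.eta, φ.apply_symm_apply]
      _ = φ.symm (S.symm (G.r e)) := by rw [← hg, hS]

theorem IsDisjointUnionOfSimpleCycles.bijective_s (h : G.IsDisjointUnionOfSimpleCycles) :
    Function.Bijective G.s := by
  obtain ⟨ι, n, -, φ, ψ, hs, -⟩ := h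
  have hcycles : Function.Bijective (disjointUnion fun i => cycle (n i)).s :=
    (Equiv.sigmaCongrRight fun i => Equiv.refl (Fin (n i))).bijective
  rw [← φ.comp_bijective, ← (funext hs : _ ∘ ψ = φ ∘ G.s)]
  exact hcycles.comp ψ.bijective

theorem IsDisjointUnionOfSimpleCycles.bijective_r (h : G.IsDisjointUnionOfSimpleCycles) :
    Function.Bijective G.r := by
  obtain ⟨ι, n, -, φ, ψ, -, hr⟩ := h
  have hcycles : Function.Bijective (disjointUnion fun i => cycle (n i)).r :=
    (Equiv.sigmaCongrRight fun i => finRotate (n i)).bijective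
  rw [← φ.comp_bijective, ← (funext hr : _ ∘ ψ = φ ∘ G.r)]
  exact hcycles.comp ψ.bijective

end cycles

section indicators

theorem isVector_of_finite_support {ξ : G.E → ℂ} (h : ξ.support.Finite) : G.IsVector ξ := by
  refine ⟨fun v => summable_of_hasFiniteSupport <|
    (h.preimage Subtype.val_injective.injOn).subset fun e he => ?_, ?_⟩
  · simpa using he
  · rw [cocompact_eq_cofinite]
    refine tendsto_const_nhds.congr' ?_
    filter_upwards [(h.image G.r).compl_mem_cofinite] with v hv
    refine ((tsum_congr fun e => ?_).trans tsum_zero).symm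
    have : ξ e = 0 := by
      by_contra he
      exact hv ⟨e, he, e.2⟩
    simp [this]

open Classical in
/-- The indicator function of an edge, as a vector of `X(G)`. -/
noncomputable def edgeVector (e : G.E) : G.correspondence.carrier :=
  mkVector (Pi.single e 1) <|
    isVector_of_finite_support ((Set.finite_singleton e).subset Pi.support_single_subset)

open Classical in
/-- The indicator function of a vertex, a projection in `C₀(V)`. -/
noncomputable def vertexProj (v : G.V) : C₀(G.V, ℂ) where
  toFun := Pi.single v 1
  continuous_toFun := continuous_of_discreteTopology
  zero_at_infty' := by
    rw [cocompact_eq_cofinite]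
    refine tendsto_const_nhds.congr' ?_
    filter_upwards [(Set.finite_singleton v).compl_mem_cofinite] with w hw
    exact (Pi.single_eq_of_ne (M := fun _ => ℂ) hw 1).symm

@[simp]
theorem vertexProj_apply_self (v : G.V) : vertexProj v v = 1 := by
  classical exact Pi.single_eq_same v 1

theorem vertexProj_apply_of_ne {v w : G.V} (h : w ≠ v) : vertexProj v w = 0 := by
  classical exact Pi.single_eq_of_ne (M := fun _ => ℂ) h 1

theorem inner_edgeVector (e : G.E) (ξ : G.vectors) :
    G.correspondence.inner (edgeVector e) ξ = ξ.1 e • vertexProj (G.r e) := by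
  classical
  refine ZeroAtInftyContinuousMap.ext fun v => (innerFun_apply _ _ v).trans ?_
  rw [ZeroAtInftyContinuousMap.smul_apply]
  by_cases h : G.r e = v
  · subst h
    rw [tsum_eq_single (⟨e, rfl⟩ : {e' // G.r e' = G.r e}) fun f hf => ?_]
    · simp [edgeVector, mkVector]
    · have : f.1 ≠ e := fun h => hf (Subtype.ext h)
      simp [edgeVector, mkVector, this]
  · rw [vertexProj_apply_of_ne (Ne.symm h), smul_zero]
    refine (tsum_congr fun f => ?_).trans tsum_zero
    have : f.1 ≠ e := fun hf => h (hf ▸ f.2)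
    simp [edgeVector, mkVector, this]

theorem inner_edgeVector_self (e : G.E) :
    G.correspondence.inner (edgeVector e) (edgeVector e) = vertexProj (G.r e) :=
  (inner_edgeVector e (edgeVector e)).trans (by simp [edgeVector, mkVector])

theorem inner_edgeVector_of_ne {e f : G.E} (h : e ≠ f) :
    G.correspondence.inner (edgeVector e) (edgeVector f) = 0 :=
  (inner_edgeVector e (edgeVector f)).trans (by simp [edgeVector, mkVector, h])

theorem left_edgeVector (e : G.E) :
    G.correspondence.left (vertexProj (G.s e)) (edgeVector e) = edgeVector e := by
  refine Subtype.ext (funext fun f => (leftAction_apply _ _ f).trans ?_)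
  rcases eq_or_ne f e with rfl | hf
  · rw [vertexProj_apply_self, one_mul]
  · simp [edgeVector, mkVector, hf]

theorem noSinks_of_left_faithful (h : ∀ a, G.correspondence.left a = 0 → a = 0) : G.NoSinks := by
  intro v
  by_contra! hv
  have hleft : G.correspondence.left (vertexProj v) = 0 :=
    ContinuousLinearMap.ext fun ξ => Subtype.ext <| funext fun e =>
      (leftAction_apply _ _ e).trans (by rw [vertexProj_apply_of_ne (hv e), zero_mul]; rfl)
  have := vertexProj_apply_self v
  rw [h _ hleft] at this
  exact zero_ne_one this

end indicators

section paths

/-- The vector `e ⊗ g e ⊗ ⋯ ⊗ gⁿ e` of the tensor power of order `n + 1`. -/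
noncomputable def orbitVector (g : G.E → G.E) :
    ∀ n, G.E → (G.correspondence.tensorPow (n + 1)).carrier
  | 0, e => edgeVector e
  | n + 1, e => tmul _ _ (edgeVector e) (orbitVector g n (g e))

theorem left_orbitVector (g : G.E → G.E) (n : ℕ) (e : G.E) :
    (G.correspondence.tensorPow (n + 1)).left (vertexProj (G.s e)) (orbitVector g n e)
      = orbitVector g n e := by
  cases n with
  | zero => exact left_edgeVector e
  | succ n => exact (left_tmul ..).trans (by rw [left_edgeVector, orbitVector])

theorem inner_orbitVector_of_ne (g : G.E → G.E) (n : ℕ) {e f : G.E} (h : e ≠ f) :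
    (G.correspondence.tensorPow (n + 1)).inner (orbitVector g n e) (orbitVector g n f) = 0 := by
  cases n with
  | zero => exact inner_edgeVector_of_ne h
  | succ n => exact (inner_tmul ..).trans (by simp [inner_edgeVector_of_ne h])

variable {g : G.E → G.E} (hg : ∀ e, G.s (g e) = G.r e)
include hg

theorem inner_orbitVector_self (n : ℕ) (e : G.E) :
    (G.correspondence.tensorPow (n + 1)).inner (orbitVector g n e) (orbitVector g n e)
      = vertexProj (G.s (g^[n + 1] e)) := by
  induction n generalizing e with
  | zero => exact (inner_edgeVector_self e).trans (by rw [← hg, Function.iterate_one])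
  | succ n ih =>
    exact (inner_tmul ..).trans (by rw [inner_edgeVector_self, ← hg, left_orbitVector, ih]; rfl)

variable {n : ℕ} (h : (G.correspondence.tensorPow (n + 1)).Isomorphic (identity C₀(G.V, ℂ)))
include h

theorem s_iterate_succ_eq (e : G.E) : G.s (g^[n + 1] e) = G.s e := by
  by_contra hne
  have hmul := h.inner_left_eq_mul (vertexProj (G.s e)) (orbitVector g n e) (orbitVector g n e)
  rw [left_orbitVector, inner_orbitVector_self hg] at hmul
  have := congrArg (fun a : C₀(G.V, ℂ) => a (G.s (g^[n + 1] e))) hmul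
  simp only [ZeroAtInftyContinuousMap.mul_apply, vertexProj_apply_of_ne hne, zero_mul,
    vertexProj_apply_self, one_ne_zero] at this

theorem s_injective_of_isomorphic : Function.Injective G.s := by
  intro e f hef
  by_contra hne
  have hmul := h.inner_self_mul_inner_self (orbitVector g n e) (orbitVector g n f)
  rw [inner_orbitVector_of_ne g n hne, inner_orbitVector_self hg, inner_orbitVector_self hg,
    s_iterate_succ_eq hg h, s_iterate_succ_eq hg h, hef, mul_zero] at hmul
  have := congrArg (fun a : C₀(G.V, ℂ) => a (G.s f)) hmul
  simp at this

omit hg in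
theorem isDisjointUnionOfSimpleCycles_of_isomorphic : G.IsDisjointUnionOfSimpleCycles := by
  have hsinks : G.NoSinks := noSinks_of_left_faithful fun _ ha =>
    h.eq_zero_of_left_eq_zero (left_tensorPow_eq_zero ha n)
  choose g hg using fun e => hsinks (G.r e)
  have hs : Function.Bijective G.s := ⟨s_injective_of_isomorphic hg h, hsinks⟩
  exact isDisjointUnionOfSimpleCycles_of_periodic hs hg fun e =>
    ⟨n + 1, n.succ_pos, hs.1 (s_iterate_succ_eq hg h e)⟩

end paths

section permutation

theorem innerFun_apply_r (hr : Function.Injective G.r) (ξ η : G.vectors) (e : G.E) :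
    innerFun ξ η (G.r e) = conj (ξ.1 e) * η.1 e := by
  rw [innerFun_apply]
  exact tsum_eq_single (⟨e, rfl⟩ : {e' // G.r e' = G.r e})
    fun f hf => absurd (Subtype.ext (hr f.2)) hf

variable [Finite G.V] (hr : Function.Bijective G.r)
include hr

theorem exists_isGenerator {u : C₀(G.V, ℂ)} (hu : ∀ v, u v = 1) {α : C₀(G.V, ℂ) → C₀(G.V, ℂ)}
    (hα : ∀ a e, α a (G.r e) = a (G.s e)) : ∃ x, G.correspondence.IsGenerator u α x := by
  have : Finite G.E := Finite.of_injective _ hr.1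
  refine ⟨mkVector (fun _ => 1) (isVector_of_finite_support (Set.toFinite _)), ?_, fun ξ => ?_,
    fun a => ?_⟩
  · refine ZeroAtInftyContinuousMap.ext fun v => ?_
    obtain ⟨e, rfl⟩ := hr.2 v
    exact (innerFun_apply_r hr.1 _ _ e).trans (by simp [mkVector, hu])
  · refine Subtype.ext (funext fun e => (rightAction_apply _ _ e).trans ?_)
    exact (congrArg _ (innerFun_apply_r hr.1 _ _ e)).trans (by simp [mkVector])
  · refine Subtype.ext (funext fun e => (leftAction_apply _ _ e).trans ?_)
    exact (mul_comm _ _).trans ((congrArg _ (hα a e).symm).trans (rightAction_apply _ _ e).symm)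

theorem isomorphic_identity_of_pow_eq_one {τ : Equiv.Perm G.V} (hτ : ∀ e, τ (G.r e) = G.s e)
    {n : ℕ} (hn : τ ^ (n + 1) = 1) :
    (G.correspondence.tensorPow (n + 1)).Isomorphic (identity C₀(G.V, ℂ)) := by
  let u : C₀(G.V, ℂ) := ZeroAtInftyContinuousMap.ContinuousMap.liftZeroAtInfty 1
  have hu (v) : u v = 1 := rfl
  let α (a : C₀(G.V, ℂ)) : C₀(G.V, ℂ) := a.comp τ.toHomeomorphOfDiscrete.toCocompactMap
  have α_apply (a v) : α a v = a (τ v) := rfl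
  have iterate_α (k) (a : C₀(G.V, ℂ)) (v) : α^[k] a v = a ((τ ^ k) v) := by
    induction k generalizing a with
    | zero => rfl
    | succ k ih => rw [Function.iterate_succ_apply, ih, α_apply, pow_succ', Equiv.Perm.mul_apply]
  have α_id : α^[n + 1] = id := by
    ext a v
    rw [iterate_α, hn, Equiv.Perm.one_apply, id]
  have one_mul_u (a : C₀(G.V, ℂ)) : u * a = a := by ext v; simp [hu]
  obtain ⟨x, hx⟩ := exists_isGenerator hr hu (α := α) fun a e => by rw [α_apply, hτ]
  obtain ⟨y, hy⟩ := hx.tensorPow one_mul_u (by ext v; rw [α_apply, hu, hu]) n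
  rw [α_id] at hy
  exact hy.isomorphic_identity one_mul_u

theorem not_nonperiodic_of_bijective (hs : Function.Bijective G.s) :
    ¬ G.correspondence.Nonperiodic := by
  intro h
  let R := Equiv.ofBijective _ hr
  let τ : Equiv.Perm G.V := R.symm.trans (.ofBijective _ hs)
  have hτ (e) : τ (G.r e) = G.s e := congrArg G.s (R.symm_apply_apply e)
  obtain ⟨n, hn⟩ := Nat.exists_eq_add_one.2 (orderOf_pos τ)
  exact n.succ_ne_zero (h _ (isomorphic_identity_of_pow_eq_one hr hτ (hn ▸ pow_orderOf_eq_one τ)))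

end permutation

end DirectedGraph

theorem mainTheorem6_general (E : DirectedGraph.{u}) [Finite E.V] :
    E.correspondence.Nonperiodic ↔ ¬ E.IsDisjointUnionOfSimpleCycles := by
  refine ⟨fun h hE =>
    DirectedGraph.not_nonperiodic_of_bijective hE.bijective_r hE.bijective_s h, fun h n hn => ?_⟩
  cases n with
  | zero => rfl
  | succ n => exact absurd (DirectedGraph.isDisjointUnionOfSimpleCycles_of_isomorphic hn) h

theorem mainTheorem6 (E : DirectedGraph.{u}) [Finite E.V]
    (hsinks : E.NoSinks) (hsources : E.NoSources) :
    E.correspondence.Nonperiodic ↔ ¬ E.IsDisjointUnionOfSimpleCycles :=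
  mainTheorem6_general E
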